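/- For each integer $n\ge 1$ let $B_n$ denote the $n$-th Bell number, i.e. the number of partitions of a set with $n$ elements into non-empty blocks, and let $r=r(n)$ denote the unique real solution of $r e^{r}=n$. Then $$B_n=\frac{n!\,\exp\left(e^{r}-1\right)}{r^{n}\sqrt{2\pi r(r+1)e^{r}}}\Bigl(1+O\left(e^{-r}\right)\Bigr),$$ where the constant implied by the $O$-symbol is absolute; that is, there is a constant $C>0$ such that for every integer $n\ge 1$ the estimate holds with $O(e^{-r})$ replaced by a real number of absolute value at most $C e^{-r}$. -/

import Mathlib

/-- The `n`-th Bell number: the number of partitions of a set with `n` elements into non-empty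
pairwise disjoint blocks. -/
def bellNumber (n : ℕ) : ℕ :=
  Fintype.card (Finpartition (Finset.univ : Finset (Fin n)))

/-- For every natural number `n`, the equation `r * exp r = n` has exactly one real solution. -/
theorem existsUnique_mul_exp_eq (n : ℕ) : ∃! r : ℝ, r * Real.exp r = (n : ℝ) := by
  have hn : (0 : ℝ) ≤ n := Nat.cast_nonneg n
  have hcont : ContinuousOn (fun r : ℝ => r * Real.exp r) (Set.Icc 0 (n : ℝ)) := by fun_prop
  have hmem : (n : ℝ) ∈ Set.Icc ((0 : ℝ) * Real.exp 0) ((n : ℝ) * Real.exp n) :=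
    ⟨by simp, le_mul_of_one_le_right hn (Real.one_le_exp hn)⟩
  obtain ⟨r, -, hr⟩ := intermediate_value_Icc hn hcont hmem
  refine ⟨r, hr, fun s hs => ?_⟩
  have nonneg : ∀ t : ℝ, t * Real.exp t = (n : ℝ) → 0 ≤ t := fun t ht =>
    nonneg_of_mul_nonneg_left (ht ▸ hn) (Real.exp_pos t)
  have strict : ∀ a b : ℝ, 0 ≤ a → a < b → a * Real.exp a < b * Real.exp b := fun a b ha hab =>
    mul_lt_mul'' hab (Real.exp_lt_exp.mpr hab) ha (Real.exp_pos a).le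
  rcases lt_trichotomy s r with h | h | h
  · exact absurd (hs.trans hr.symm) (strict s r (nonneg s hs) h).ne
  · exact h
  · exact absurd (hr.trans hs.symm) (strict r s (nonneg r hr) h).ne

/-- The Lambert function at `n`: the solution `r = r(n)` of `r * exp r = n`. -/
noncomputable def lambertR (n : ℕ) : ℝ :=
  (existsUnique_mul_exp_eq n).choose

theorem lambertR_mul_exp (n : ℕ) : lambertR n * Real.exp (lambertR n) = (n : ℝ) :=
  (existsUnique_mul_exp_eq n).choose_spec.1

/-- The main term `n! exp(e^r - 1) / (r^n √(2π r (r+1) e^r))` with `r = r(n)`. -/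
noncomputable def bellMainTerm (n : ℕ) : ℝ :=
  (n.factorial : ℝ) * Real.exp (Real.exp (lambertR n) - 1) /
    (lambertR n ^ n *
      Real.sqrt (2 * Real.pi * lambertR n * (lambertR n + 1) * Real.exp (lambertR n)))

/-! Dobinski's formula identifies the coefficients of `exp (exp z)` as `e * B_n / n!`, so `B_n` is a
Cauchy integral over `|z| = r`. With `r * exp r = n` the linear phase cancels and the integrand
becomes `exp (saddleExponent r θ)`, up to a constant factor. Put `S = A θ²` with `A =
saddleQuadratic r`, and `x = r|θ|`, so `e^r x² ≤ S`. The cubic term of the exponent is at most `e^r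
x³`, of square at most `e^{-r} S³`; the quartic remainder is `O(e^{-r} S²)`. Keeping the cubic to
first order in `saddleApprox` leaves a pointwise error of order `e^{-r}`, and being odd it
integrates to zero. Hence the relative error is `e^{-r}`, not `e^{-r/2}`.
`exists_norm_indicator_sub_saddleApprox_le` bounds the error on the whole line by a multiple of
`e^{-r} / (1 + S)`: by Taylor expansion for `x ≤ 1`, by the smallness of both functions for `x ≥ 1`.
Integration gives the theorem for `r ≥ 1`, in particular for `n ≥ 3`. -/

open MeasureTheory

/-! ### Set partitions and Dobinski's formula -/

/-- Functions with kernel `s` correspond to embeddings of the quotient by `s`. -/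
def Setoid.kerFiberEquiv {α : Type*} (s : Setoid α) (β : Type*) :
    {f : α → β // Setoid.ker f = s} ≃ (Quotient s ↪ β) where
  toFun f := ⟨Quotient.lift f.1 fun a b h => by
      have h' : s a b := h
      rw [← f.2] at h'
      exact h', by
    rintro ⟨a⟩ ⟨b⟩ h
    apply Quotient.sound
    change s a b
    rw [← f.2]
    exact h⟩
  invFun e := ⟨fun a => e (Quotient.mk s a), by
    ext a b
    rw [Setoid.ker_def, e.injective.eq_iff, Quotient.eq]⟩
  left_inv f := rfl
  right_inv e := by
    ext ⟨a⟩
    rfl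

theorem bellNumber_eq_card_setoid (n : ℕ) : bellNumber n = Nat.card (Setoid (Fin n)) := by
  classical
  rw [bellNumber, ← Nat.card_eq_fintype_card]
  refine (Nat.card_congr (Equiv.ofBijective
    (fun s : Setoid (Fin n) => Finpartition.ofSetoid s) ⟨fun s t h => ?_, fun P => ?_⟩)).symm
  · ext a b
    rw [← Finpartition.mem_part_ofSetoid_iff_rel, ← Finpartition.mem_part_ofSetoid_iff_rel]
    simp only at h
    rw [h]
  -- Surjectivity: `P` comes from the kernel of the map sending a point to its block.
  · have hpart : ∀ a, (Finpartition.ofSetoid (Setoid.ker P.part)).part a = P.part a := fun a => by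
      ext b
      rw [Finpartition.mem_part_ofSetoid_iff_rel, Setoid.ker_def,
        P.mem_part_iff_part_eq_part (Finset.mem_univ b) (Finset.mem_univ a), eq_comm]
    refine ⟨Setoid.ker P.part, Finpartition.ext ?_⟩
    ext t
    constructor
    · intro ht
      obtain ⟨a, ha⟩ := Finpartition.nonempty_of_mem_parts _ ht
      rw [← Finpartition.part_eq_of_mem _ ht ha, hpart]
      exact P.part_mem.2 (Finset.mem_univ a)
    · intro ht
      obtain ⟨a, ha⟩ := P.nonempty_of_mem_parts ht
      rw [← P.part_eq_of_mem ht ha, ← hpart]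
      exact Finpartition.part_mem _ |>.2 (Finset.mem_univ a)

/-- Sort the maps `Fin n → Fin k` by kernel; those with kernel `s` are the injections of the
quotient by `s`. -/
theorem pow_eq_sum_descFactorial (n k : ℕ) [Fintype (Setoid (Fin n))] :
    k ^ n = ∑ s : Setoid (Fin n), k.descFactorial (Nat.card (Quotient s)) := by
  classical
  have h := Nat.card_congr (Equiv.sigmaFiberEquiv (Setoid.ker : (Fin n → Fin k) → Setoid (Fin n)))
  rw [Nat.card_sigma] at h
  rw [Nat.card_eq_fintype_card (α := Fin n → Fin k)] at h
  simp only [Fintype.card_fun, Fintype.card_fin] at h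
  rw [← h]
  refine Finset.sum_congr rfl fun s _ => ?_
  rw [Nat.card_congr (Setoid.kerFiberEquiv s (Fin k)), Nat.card_eq_fintype_card,
    Fintype.card_embedding_eq, Fintype.card_fin, Nat.card_eq_fintype_card]

theorem hasSum_descFactorial_div_factorial (m : ℕ) :
    HasSum (fun k : ℕ => (k.descFactorial m : ℝ) / k.factorial) (Real.exp 1) := by
  rw [← hasSum_nat_add_iff' m, Finset.sum_eq_zero, sub_zero]
  · have h : HasSum (fun k : ℕ => (1 : ℝ) ^ k / k.factorial) (Real.exp 1) := by
      rw [Real.exp_eq_exp_ℝ]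
      exact NormedSpace.expSeries_div_hasSum_exp 1
    refine (iff_of_eq (congrArg (HasSum · (Real.exp 1)) (funext fun k => ?_))).2 h
    have h1 := Nat.factorial_mul_descFactorial (Nat.le_add_left m k)
    rw [Nat.add_sub_cancel] at h1
    rw [← h1, one_pow]
    have : ((k + m).descFactorial m : ℝ) ≠ 0 := by
      have := Nat.descFactorial_eq_zero_iff_lt (n := k + m) (k := m)
      norm_cast
      omega
    have : (k.factorial : ℝ) ≠ 0 := by positivity
    push_cast
    field_simp
  · intro k hk
    rw [Nat.descFactorial_of_lt (Finset.mem_range.1 hk)]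
    simp

/-- Dobinski's formula. -/
theorem hasSum_pow_div_factorial (n : ℕ) :
    HasSum (fun k : ℕ => (k : ℝ) ^ n / k.factorial) (bellNumber n * Real.exp 1) := by
  classical
  have : Finite (Setoid (Fin n)) :=
    Finite.of_injective (fun s : Setoid (Fin n) => (s : Fin n → Fin n → Prop))
      fun s t h => Setoid.ext fun a b => by simp only at h; rw [h]
  have := Fintype.ofFinite (Setoid (Fin n))
  have h := hasSum_sum (s := Finset.univ) fun (s : Setoid (Fin n)) _ =>
    hasSum_descFactorial_div_factorial (Nat.card (Quotient s))
  rw [Finset.sum_const, nsmul_eq_mul, Finset.card_univ, ← Nat.card_eq_fintype_card,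
    ← bellNumber_eq_card_setoid] at h
  convert h using 2 with k
  rw [← Finset.sum_div]
  congr 1
  exact_mod_cast pow_eq_sum_descFactorial n k

/-! ### Cauchy's formula on the circle of radius `r` -/

theorem intervalIntegral_cexp_mul_circle (n : ℕ) (c : ℂ) {r : ℝ} (hr : 0 < r) :
    ∫ θ in (-Real.pi)..Real.pi, Complex.exp (c * (r * Complex.exp (θ * Complex.I))) *
      Complex.exp (-(n * θ * Complex.I)) = 2 * Real.pi * (c * r) ^ n / n.factorial := by
  have hper : Function.Periodic (fun θ : ℝ => Complex.exp (c * (r * Complex.exp (θ * Complex.I))) *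
      Complex.exp (-(n * θ * Complex.I))) (2 * Real.pi) := fun θ => by
    have h1 : Complex.exp (((θ + 2 * Real.pi : ℝ) : ℂ) * Complex.I) =
        Complex.exp (θ * Complex.I) := by
      rw [← Complex.exp_periodic (θ * Complex.I)]
      push_cast
      ring_nf
    have h2 : ∀ t : ℝ, Complex.exp (-(n * t * Complex.I)) = (Complex.exp (t * Complex.I) ^ n)⁻¹ :=
      fun t => by rw [← Complex.exp_nat_mul, ← Complex.exp_neg]; ring_nf
    simp only [h2, h1]
  have hshift := hper.intervalIntegral_add_eq (-Real.pi) 0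
  rw [show -Real.pi + 2 * Real.pi = Real.pi by ring, zero_add] at hshift
  rw [hshift]
  have hd : DiffContOnCl ℂ (fun z => Complex.exp (c * z)) (Metric.ball 0 r) :=
    (by fun_prop : Differentiable ℂ fun z => Complex.exp (c * z)).diffContOnCl
  have h := hd.circleIntegral_one_div_sub_center_pow_smul hr n
  rw [iteratedDeriv_cexp_const_mul] at h
  simp only [circleIntegral, deriv_circleMap, sub_zero, smul_eq_mul, mul_zero, Complex.exp_zero,
    mul_one] at h
  have hr' : (r : ℂ) ≠ 0 := by exact_mod_cast hr.ne'
  have e : ∀ θ : ℝ, circleMap 0 r θ * Complex.I * (1 / circleMap 0 r θ ^ (n + 1) *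
      Complex.exp (c * circleMap 0 r θ)) = Complex.I / r ^ n *
      (Complex.exp (c * (r * Complex.exp (θ * Complex.I))) *
      Complex.exp (-(n * θ * Complex.I))) := fun θ => by
    have h0 := Complex.exp_ne_zero (θ * Complex.I)
    rw [Complex.exp_neg, mul_assoc (n : ℂ), Complex.exp_nat_mul, circleMap_zero]
    field_simp
    ring
  simp only [e] at h
  rw [intervalIntegral.integral_const_mul] at h
  have hI := Complex.I_ne_zero
  have hf : (n.factorial : ℂ) ≠ 0 := by exact_mod_cast n.factorial_ne_zero
  generalize (∫ θ in (0 : ℝ)..(2 * Real.pi), Complex.exp (c * (r * Complex.exp (θ * Complex.I))) *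
      Complex.exp (-(n * θ * Complex.I))) = J at h ⊢
  field_simp at h ⊢
  rw [mul_pow]
  linear_combination h

/-- Cauchy's formula for the coefficients of `exp (exp z)`. -/
theorem intervalIntegral_cexp_cexp_circle (n : ℕ) {r : ℝ} (hr : 0 < r) :
    ∫ θ in (-Real.pi)..Real.pi, Complex.exp (Complex.exp (r * Complex.exp (θ * Complex.I))) *
      Complex.exp (-(n * θ * Complex.I)) =
        2 * Real.pi * r ^ n / n.factorial * (bellNumber n * Real.exp 1) := by
  have hn : ∀ (k : ℕ) (θ : ℝ), ‖Complex.exp (k * (r * Complex.exp (θ * Complex.I))) *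
      Complex.exp (-(n * θ * Complex.I)) / k.factorial‖ ≤ Real.exp r ^ k / k.factorial := by
    intro k θ
    rw [norm_div, norm_mul, Complex.norm_exp, Complex.norm_exp, Complex.norm_natCast,
      ← Real.exp_nat_mul]
    gcongr
    have : (-((n : ℂ) * θ * Complex.I)).re = 0 := by simp
    rw [this, Real.exp_zero, mul_one, Real.exp_le_exp]
    refine (Complex.re_le_norm _).trans ?_
    rw [norm_mul, norm_mul, Complex.norm_exp_ofReal_mul_I, Complex.norm_natCast, Complex.norm_real,
      Real.norm_of_nonneg hr.le, mul_one]
  -- Expand the outer exponential in powers of `exp z` and integrate termwise, dominated by `(e^r)^k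
  -- / k!`; the results form Dobinski's series.
  have h1 := intervalIntegral.hasSum_integral_of_dominated_convergence (μ := volume)
    (a := -Real.pi) (b := Real.pi)
    (F := fun (k : ℕ) (θ : ℝ) => Complex.exp (k * (r * Complex.exp (θ * Complex.I))) *
      Complex.exp (-(n * θ * Complex.I)) / k.factorial)
    (f := fun θ : ℝ => Complex.exp (Complex.exp (r * Complex.exp (θ * Complex.I))) *
      Complex.exp (-(n * θ * Complex.I)))
    (fun k _ => Real.exp r ^ k / k.factorial)
    (fun k => (by fun_prop : Continuous _).aestronglyMeasurable)
    (fun k => Filter.Eventually.of_forall fun θ _ => hn k θ)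
    (Filter.Eventually.of_forall fun θ _ => Real.summable_pow_div_factorial _)
    (by simp)
    (Filter.Eventually.of_forall fun θ _ => by
      have h := NormedSpace.expSeries_div_hasSum_exp (Complex.exp (r * Complex.exp (θ * Complex.I)))
      rw [← Complex.exp_eq_exp_ℂ] at h
      refine (iff_of_eq (congrArg (HasSum · _) (funext fun k => ?_))).2
        (h.mul_right (Complex.exp (-(n * θ * Complex.I))))
      rw [Complex.exp_nat_mul]
      ring)
  have h2 := ((Complex.hasSum_ofReal ).2 (hasSum_pow_div_factorial n)).mul_left
    (2 * Real.pi * r ^ n / n.factorial : ℂ)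
  push_cast at h2
  refine h1.unique ?_
  push_cast
  refine (iff_of_eq (congrArg (HasSum · _) (funext fun k => ?_))).2 h2
  rw [intervalIntegral.integral_div, intervalIntegral_cexp_mul_circle n k hr, mul_pow]
  ring

/-! ### Taylor estimates -/

/-- The mean value inequality with the crude constant `C |t|^k`. Iterated, it gives Taylor
remainders without the factorial, which suffices here. -/
theorem norm_le_of_hasDerivAt_norm_le_pow {F F' : ℝ → ℂ} (hF : ∀ x, HasDerivAt F (F' x) x)
    (h0 : F 0 = 0) {C : ℝ} (hC : 0 ≤ C) {k : ℕ} {t : ℝ}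
    (hb : ∀ x ∈ Set.uIcc 0 t, ‖F' x‖ ≤ C * |x| ^ k) : ‖F t‖ ≤ C * |t| ^ (k + 1) := by
  have h := (convex_uIcc (0 : ℝ) t).norm_image_sub_le_of_norm_hasDerivWithin_le
    (C := C * |t| ^ k) (fun x _ => (hF x).hasDerivWithinAt) (fun x hx => (hb x hx).trans ?_)
    Set.left_mem_uIcc Set.right_mem_uIcc
  · rw [h0, sub_zero, sub_zero, Real.norm_eq_abs] at h
    rwa [pow_succ, ← mul_assoc]
  · have : |x| ≤ |t| := by
      have := Set.abs_sub_left_of_mem_uIcc hx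
      simpa using this
    gcongr

/-- Along the segment from `0` to `w` the exponential is bounded by this maximum. A bound through
`w.re` rather than `‖w‖` is essential later, where only the real part is controlled. -/
theorem norm_cexp_sub_one_sub_id_le_sq_mul_max (w : ℂ) :
    ‖Complex.exp w - 1 - w‖ ≤ ‖w‖ ^ 2 * max 1 (Real.exp w.re) := by
  set M := max 1 (Real.exp w.re) with hM
  have hM0 : 0 ≤ M := zero_le_one.trans (le_max_left _ _)
  have hE : ∀ t : ℝ, HasDerivAt (fun t : ℝ => Complex.exp (t * w)) (Complex.exp (t * w) * w) t := by
    intro t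
    have := ((hasDerivAt_id t).ofReal_comp.mul_const w).cexp
    simpa using this
  have hbound : ∀ t : ℝ, 0 ≤ t → t ≤ 1 → ‖Complex.exp (t * w)‖ ≤ M := fun t h0 h1 => by
    rw [Complex.norm_exp, Complex.re_ofReal_mul]
    rcases le_total w.re 0 with h | h
    · exact (Real.exp_le_one_iff.2 (mul_nonpos_of_nonneg_of_nonpos h0 h)).trans (le_max_left _ _)
    · exact (Real.exp_le_exp.2 (mul_le_of_le_one_left h h1)).trans (le_max_right _ _)
  have h1 : ∀ t : ℝ, 0 ≤ t → t ≤ 1 → ‖Complex.exp (t * w) - 1‖ ≤ ‖w‖ * M * |t| ^ (0 + 1) := by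
    intro t ht0 ht1
    refine norm_le_of_hasDerivAt_norm_le_pow (F := fun t : ℝ => Complex.exp (t * w) - 1)
      (fun x => (hE x).sub_const 1) (by simp) (by positivity) fun x hx => ?_
    rw [Set.uIcc_of_le ht0] at hx
    rw [norm_mul, pow_zero, mul_one, mul_comm]
    gcongr
    exact hbound x hx.1 (hx.2.trans ht1)
  have h2 := norm_le_of_hasDerivAt_norm_le_pow (F := fun t : ℝ => Complex.exp (t * w) - 1 - t * w)
    (F' := fun t => Complex.exp (t * w) * w - w) (C := ‖w‖ ^ 2 * M) (k := 1) (t := 1)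
    (fun x => ((hE x).sub_const 1).sub
      (by simpa using (hasDerivAt_id x).ofReal_comp.mul_const w)) (by simp) (by positivity)
    fun x hx => ?_
  · simpa using h2
  · rw [Set.uIcc_of_le zero_le_one] at hx
    rw [show Complex.exp (x * w) * w - w = w * (Complex.exp (x * w) - 1) by ring, norm_mul, sq]
    calc ‖w‖ * ‖Complex.exp (x * w) - 1‖ ≤ ‖w‖ * (‖w‖ * M * |x| ^ (0 + 1)) := by
          gcongr
          exact h1 x hx.1 hx.2
      _ = ‖w‖ * ‖w‖ * M * |x| ^ 1 := by ring

theorem norm_cexp_circle_sub_one_le {r : ℝ} (hr : 0 ≤ r) (θ : ℝ) :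
    ‖Complex.exp (r * (Complex.exp (θ * Complex.I) - 1))‖ ≤ 1 := by
  rw [Complex.norm_exp, Real.exp_le_one_iff, Complex.re_ofReal_mul, Complex.sub_re,
    Complex.exp_ofReal_mul_I_re, Complex.one_re]
  exact mul_nonpos_of_nonneg_of_nonpos hr (sub_nonpos.2 (Real.cos_le_one θ))

/-- The derivatives of `G` are Touchard polynomials in `r u` times `G`. The fourth has coefficients
`1, 7, 6, 1`, of sum `15`; as `‖u‖ = 1`, `‖G‖ ≤ 1` and `r ≥ 1`, it is at most `15 r⁴`. Four
integrations from `0` follow. -/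
theorem norm_cexp_circle_sub_taylor_le {r : ℝ} (hr : 1 ≤ r) (θ : ℝ) :
    ‖Complex.exp (r * (Complex.exp (θ * Complex.I) - 1)) - 1 - Complex.I * r * θ +
      (r + r ^ 2) * θ ^ 2 / 2 + Complex.I * (r + 3 * r ^ 2 + r ^ 3) * θ ^ 3 / 6‖ ≤
      15 * r ^ 4 * |θ| ^ 4 := by
  have hr0 : 0 ≤ r := zero_le_one.trans hr
  set u : ℝ → ℂ := fun θ => Complex.exp (θ * Complex.I) with hu
  set G : ℝ → ℂ := fun θ => Complex.exp (r * (u θ - 1)) with hG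
  have du : ∀ t, HasDerivAt u (u t * Complex.I) t := fun t => by
    have := ((hasDerivAt_id t).ofReal_comp.mul_const Complex.I).cexp
    simpa using this
  have dG : ∀ t, HasDerivAt G (G t * (r * (u t * Complex.I))) t := fun t =>
    (((du t).sub_const 1).const_mul (r : ℂ)).cexp
  have did : ∀ t : ℝ, HasDerivAt (fun t : ℝ => (t : ℂ)) 1 t := fun t =>
    (hasDerivAt_id t).ofReal_comp
  have hI : Complex.I ^ 2 = -1 := Complex.I_sq
  have u0 : u 0 = 1 := by simp [hu]
  have G0 : G 0 = 1 := by simp [hG, u0]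
  have nu : ∀ t, ‖u t‖ = 1 := fun t => Complex.norm_exp_ofReal_mul_I t
  have nG : ∀ t, ‖G t‖ ≤ 1 := norm_cexp_circle_sub_one_le hr0
  set a : ℂ := r + r ^ 2 with ha
  set b : ℂ := r + 3 * r ^ 2 + r ^ 3 with hb
  have h4 : ∀ t, ‖(r * u t + 7 * r ^ 2 * u t ^ 2 + 6 * r ^ 3 * u t ^ 3 + r ^ 4 * u t ^ 4) * G t‖ ≤
      15 * r ^ 4 * |t| ^ 0 := fun t => by
    have e1 : r ≤ r ^ 4 := le_self_pow₀ hr (by norm_num)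
    have e2 : r ^ 2 ≤ r ^ 4 := pow_le_pow_right₀ hr (by norm_num)
    have e3 : r ^ 3 ≤ r ^ 4 := pow_le_pow_right₀ hr (by norm_num)
    calc _ ≤ (r + 7 * r ^ 2 + 6 * r ^ 3 + r ^ 4) * 1 := by
          rw [norm_mul]
          gcongr
          · refine norm_add₄_le.trans (le_of_eq ?_)
            simp [nu, abs_of_nonneg hr0]
          · exact nG t
      _ ≤ _ := by rw [pow_zero]; linarith
  have h3 : ∀ t, ‖-Complex.I * (r * u t + 3 * r ^ 2 * u t ^ 2 + r ^ 3 * u t ^ 3) * G t +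
      Complex.I * b‖ ≤ 15 * r ^ 4 * |t| ^ 1 := fun t => by
    refine norm_le_of_hasDerivAt_norm_le_pow
      (F := fun t => -Complex.I * (r * u t + 3 * r ^ 2 * u t ^ 2 + r ^ 3 * u t ^ 3) * G t +
        Complex.I * b) (fun x => ?_) ?_ (by positivity) fun x _ => h4 x
    · have := (((((du x).const_mul (r : ℂ)).add (((du x).pow 2).const_mul (3 * r ^ 2 : ℂ))).add
        (((du x).pow 3).const_mul (r ^ 3 : ℂ))).const_mul (-Complex.I)).mul (dG x)
          |>.add_const (Complex.I * b)
      refine this.congr_deriv ?_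
      simp only [Pi.add_apply, Pi.pow_apply]
      push_cast
      linear_combination (-(G x) * (r * u x + 7 * r ^ 2 * u x ^ 2 + 6 * r ^ 3 * u x ^ 3 +
        r ^ 4 * u x ^ 4)) * hI
    · simp only [u0, G0, hb]; ring
  have h2 : ∀ t : ℝ, ‖-(r * u t + r ^ 2 * u t ^ 2) * G t + a + Complex.I * b * t‖ ≤
      15 * r ^ 4 * |t| ^ 2 := fun t => by
    refine norm_le_of_hasDerivAt_norm_le_pow
      (F := fun t : ℝ => -(r * u t + r ^ 2 * u t ^ 2) * G t + a + Complex.I * b * t)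
      (fun x => ?_) ?_ (by positivity) fun x _ => h3 x
    · have := ((((du x).const_mul (r : ℂ)).add (((du x).pow 2).const_mul (r ^ 2 : ℂ))).neg.mul
        (dG x)).add_const a |>.add ((did x).const_mul (Complex.I * b))
      refine this.congr_deriv ?_
      simp only [Pi.add_apply, Pi.pow_apply, Pi.neg_apply]
      push_cast
      ring
    · simp only [u0, G0, ha]; push_cast; ring
  have h1 : ∀ t : ℝ, ‖G t * (r * (u t * Complex.I)) - Complex.I * r + a * t +
      Complex.I * b * t ^ 2 / 2‖ ≤ 15 * r ^ 4 * |t| ^ 3 := fun t => by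
    refine norm_le_of_hasDerivAt_norm_le_pow
      (F := fun t : ℝ => G t * (r * (u t * Complex.I)) - Complex.I * r + a * t +
      Complex.I * b * t ^ 2 / 2) (fun x => ?_) ?_ (by positivity) fun x _ => h2 x
    · have := ((dG x).mul (((du x).mul_const Complex.I).const_mul (r : ℂ))).sub_const
        (Complex.I * r) |>.add ((did x).const_mul a) |>.add
        ((((did x).pow 2).const_mul (Complex.I * b)).div_const 2)
      refine this.congr_deriv ?_
      push_cast
      linear_combination (G x * (r * u x + r ^ 2 * u x ^ 2)) * hI
    · simp only [u0, G0]; push_cast; ring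
  refine norm_le_of_hasDerivAt_norm_le_pow
      (F := fun θ : ℝ => G θ - 1 - Complex.I * r * θ + a * θ ^ 2 / 2 + Complex.I * b * θ ^ 3 / 6)
      (fun x => ?_) ?_ (by positivity) fun x _ => h1 x
  · have := ((dG x).sub_const 1).sub ((did x).const_mul (Complex.I * r)) |>.add
      ((((did x).pow 2).const_mul a).div_const 2) |>.add
      ((((did x).pow 3).const_mul (Complex.I * b)).div_const 6)
    refine this.congr_deriv ?_
    push_cast
    ring
  · simp only [G0]; push_cast; ring

/-! ### The exponent at the saddle: expansion and decay -/

/-- The exponent `exp (r e^{iθ}) - e^r - i r e^r θ` of the integrand on the saddle circle. -/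
noncomputable def saddleExponent (r θ : ℝ) : ℂ :=
  Real.exp r * (Complex.exp (r * (Complex.exp (θ * Complex.I) - 1)) - 1 - Complex.I * r * θ)

/-- The coefficient of `-θ²/2` in the Taylor expansion of `saddleExponent r`. -/
noncomputable def saddleQuadratic (r : ℝ) : ℝ := r * (r + 1) * Real.exp r

/-- The coefficient of `-iθ³` in the Taylor expansion of `saddleExponent r`. -/
noncomputable def saddleCubic (r : ℝ) : ℝ := (r + 3 * r ^ 2 + r ^ 3) / 6 * Real.exp r

theorem sq_mul_exp_mul_sq_le_saddleQuadratic_mul_sq {r : ℝ} (hr : 1 ≤ r) (θ : ℝ) :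
    Real.exp r * (r * |θ|) ^ 2 ≤ saddleQuadratic r * θ ^ 2 := by
  rw [mul_pow, sq_abs, saddleQuadratic]
  nlinarith [mul_nonneg (mul_nonneg (Real.exp_pos r).le (zero_le_one.trans hr)) (sq_nonneg θ)]

theorem saddleCubic_nonneg {r : ℝ} (hr : 1 ≤ r) : 0 ≤ saddleCubic r := by
  unfold saddleCubic
  positivity

theorem saddleCubic_mul_le {r : ℝ} (hr : 1 ≤ r) (θ : ℝ) :
    saddleCubic r * |θ| ^ 3 ≤ Real.exp r * (r * |θ|) ^ 3 := by
  have h1 : (r + 3 * r ^ 2 + r ^ 3) / 6 ≤ r ^ 3 := by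
    nlinarith [mul_nonneg (sub_nonneg.2 hr) (zero_le_one.trans hr),
      mul_nonneg (mul_nonneg (sub_nonneg.2 hr) (zero_le_one.trans hr)) (zero_le_one.trans hr)]
  rw [saddleCubic, mul_pow, ← mul_assoc, mul_comm (Real.exp r)]
  gcongr

theorem norm_saddleExponent_sub_taylor_le {r : ℝ} (hr : 1 ≤ r) (θ : ℝ) :
    ‖saddleExponent r θ + ((saddleQuadratic r * θ ^ 2 / 2 : ℝ) : ℂ) +
      Complex.I * ((saddleCubic r * θ ^ 3 : ℝ) : ℂ)‖ ≤ 15 * (Real.exp r * (r * |θ|) ^ 4) := by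
  have h := mul_le_mul_of_nonneg_left (norm_cexp_circle_sub_taylor_le hr θ) (Real.exp_pos r).le
  calc _ = Real.exp r * _ := by
        rw [← Real.norm_of_nonneg (Real.exp_pos r).le, ← Complex.norm_real, ← norm_mul]
        congr 1
        rw [saddleExponent, saddleQuadratic, saddleCubic]
        push_cast
        ring
    _ ≤ _ := h
    _ = _ := by ring

theorem saddleExponent_re (r θ : ℝ) : (saddleExponent r θ).re =
    Real.exp r * (Real.exp (r * (Real.cos θ - 1)) * Real.cos (r * Real.sin θ) - 1) := by
  rw [saddleExponent, Complex.re_ofReal_mul, Complex.sub_re, Complex.sub_re, Complex.exp_re,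
    Complex.re_ofReal_mul, Complex.im_ofReal_mul, Complex.sub_re, Complex.sub_im,
    Complex.exp_ofReal_mul_I_re, Complex.exp_ofReal_mul_I_im]
  simp

/-- The decay comes from `cos (r sin θ)` alone, by `cos y ≤ 1 - 2y²/π²` and `|sin θ| ≥ 2|θ|/π`. Here
`8/π⁴ ≥ 2/25`, and `r² ≥ r(r+1)/2` costs the last factor `2`. -/
theorem saddleExponent_re_le_of_abs_le {r θ : ℝ} (hr : 1 ≤ r) (h : r * |θ| ≤ 1) :
    (saddleExponent r θ).re ≤ -(saddleQuadratic r * θ ^ 2 / 25) := by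
  have hr0 : 0 < r := by linarith
  have hpi := Real.pi_pos
  have hθ1 : |θ| ≤ 1 := by nlinarith [abs_nonneg θ]
  have hsin_le : |Real.sin θ| ≤ |θ| := Real.abs_sin_le_abs
  have hx : |r * Real.sin θ| ≤ 1 := by
    rw [abs_mul, abs_of_pos hr0]
    nlinarith
  have hsin : 2 / Real.pi * |θ| ≤ |Real.sin θ| := by
    have h1 := Real.mul_le_sin (abs_nonneg θ) (by linarith [Real.pi_gt_three])
    refine h1.trans ?_
    rcases abs_cases θ with h | h <;> rw [h.1]
    · exact le_abs_self _
    · rw [Real.sin_neg]; exact neg_le_abs _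
  have hcos := Real.cos_le_one_sub_mul_cos_sq (x := r * Real.sin θ)
    (by linarith [Real.pi_gt_three])
  have hcos0 : 0 ≤ Real.cos (r * Real.sin θ) := by
    refine Real.cos_nonneg_of_mem_Icc ⟨?_, ?_⟩ <;>
    linarith [abs_le.1 hx, Real.pi_gt_three, (abs_le.1 hx).1, (abs_le.1 hx).2]
  have hexp : Real.exp (r * (Real.cos θ - 1)) ≤ 1 :=
    Real.exp_le_one_iff.2 (mul_nonpos_of_nonneg_of_nonpos hr0.le (by linarith [Real.cos_le_one θ]))
  have hsq : (2 / Real.pi * |θ|) ^ 2 ≤ Real.sin θ ^ 2 := by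
    rw [← sq_abs (Real.sin θ)]
    gcongr
  have hpi4 : 2 / 25 ≤ 2 / Real.pi ^ 2 * (2 / Real.pi) ^ 2 := by
    have : Real.pi ^ 2 ≤ 9.9 := by nlinarith [Real.pi_lt_d4]
    have h2 : Real.pi ^ 2 * Real.pi ^ 2 ≤ 100 := by nlinarith [sq_nonneg Real.pi]
    rw [div_pow, div_mul_div_comm, div_le_div_iff₀ (by norm_num) (by positivity)]
    nlinarith
  rw [saddleExponent_re, saddleQuadratic]
  have key : Real.exp (r * (Real.cos θ - 1)) * Real.cos (r * Real.sin θ) - 1 ≤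
      -(2 / 25 * (r ^ 2 * θ ^ 2)) := by
    have h3 : 2 / Real.pi ^ 2 * (r * (2 / Real.pi * |θ|)) ^ 2 ≤
        2 / Real.pi ^ 2 * (r * Real.sin θ) ^ 2 := by
      rw [mul_pow r, mul_pow r]
      gcongr
    have h4 : 2 / Real.pi ^ 2 * (r * (2 / Real.pi * |θ|)) ^ 2 =
        2 / Real.pi ^ 2 * (2 / Real.pi) ^ 2 * (r ^ 2 * θ ^ 2) := by
      rw [← sq_abs θ]
      ring
    have h5 := mul_le_mul_of_nonneg_right hpi4 (by positivity : 0 ≤ r ^ 2 * θ ^ 2)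
    have h6 := mul_le_of_le_one_left hcos0 hexp
    linarith
  have h7 := mul_le_mul_of_nonneg_left key (Real.exp_pos r).le
  refine h7.trans ?_
  have h8 : 0 ≤ Real.exp r * θ ^ 2 * (r * (r - 1)) :=
    mul_nonneg (by positivity) (mul_nonneg hr0.le (by linarith))
  nlinarith

/-- Away from the saddle the decay comes from `e^{-y} ≤ 1/(1+y)` with `rθ²/5 ≤ y ≤ 2r`, the
oscillating cosine being bounded by `1`. The loss of `r²` is harmless where `S ≥ e^r`. -/
theorem saddleExponent_re_le {r θ : ℝ} (hr : 1 ≤ r) (h : |θ| ≤ Real.pi) :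
    (saddleExponent r θ).re ≤ -(saddleQuadratic r * θ ^ 2 / (30 * r ^ 2)) := by
  have hr0 : 0 < r := by linarith
  have hpi := Real.pi_pos
  have hpi2 : Real.pi ^ 2 ≤ 10 := by nlinarith [Real.pi_lt_d4]
  have hθ : θ ^ 2 ≤ Real.pi ^ 2 := by rw [← sq_abs]; gcongr
  have hcos := Real.cos_le_one_sub_mul_cos_sq h
  set y := r * (1 - Real.cos θ) with hy
  have hy0 : 0 ≤ y := mul_nonneg hr0.le (by linarith [Real.cos_le_one θ])
  have hy2 : y ≤ 2 * r := by nlinarith [Real.neg_one_le_cos θ]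
  have hy1 : r * θ ^ 2 / 5 ≤ y := by
    have : 1 / 5 ≤ 2 / Real.pi ^ 2 := by
      rw [div_le_div_iff₀ (by norm_num) (by positivity)]; linarith
    have := mul_le_mul_of_nonneg_right this (sq_nonneg θ)
    nlinarith
  have he : Real.exp (r * (Real.cos θ - 1)) ≤ 1 / (1 + y) := by
    rw [show r * (Real.cos θ - 1) = -y by rw [hy]; ring, Real.exp_neg, ← one_div]
    gcongr
    linarith [Real.add_one_le_exp y]
  have key : Real.exp (r * (Real.cos θ - 1)) * Real.cos (r * Real.sin θ) - 1 ≤ -(θ ^ 2 / 15) := by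
    have h1 : Real.exp (r * (Real.cos θ - 1)) * Real.cos (r * Real.sin θ) ≤ 1 / (1 + y) :=
      (mul_le_of_le_one_right (Real.exp_pos _).le (Real.cos_le_one _)).trans he
    have h2 : 1 / (1 + y) ≤ 1 - θ ^ 2 / 15 := by
      rw [div_le_iff₀ (by linarith)]
      nlinarith [mul_nonneg (sq_nonneg θ) (sub_nonneg.2 hy2), mul_nonneg (sq_nonneg θ) hy0]
    linarith
  rw [saddleExponent_re, saddleQuadratic]
  refine (mul_le_mul_of_nonneg_left key (Real.exp_pos r).le).trans ?_
  rw [mul_neg, neg_le_neg_iff, div_le_iff₀ (by positivity)]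
  have h8 : 0 ≤ Real.exp r * θ ^ 2 * (r * (r - 1)) :=
    mul_nonneg (by positivity) (mul_nonneg hr0.le (by linarith))
  nlinarith

/-! ### Pointwise comparison with the corrected Gaussian -/

theorem pow_mul_exp_neg_div_le {c S : ℝ} (hc : 0 < c) (hS : 0 ≤ S) (m : ℕ) :
    S ^ m * Real.exp (-(S / c)) ≤ m.factorial * c ^ m := by
  have h := Real.pow_div_factorial_le_exp (S / c) (by positivity) m
  rw [div_pow, div_div, div_le_iff₀ (by positivity)] at h
  rw [Real.exp_neg, ← div_eq_mul_inv, div_le_iff₀ (Real.exp_pos _)]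
  linarith

/-- The Gaussian with cubic correction approximating `exp (saddleExponent r θ)`. -/
noncomputable def saddleApprox (r θ : ℝ) : ℂ :=
  Real.exp (-(saddleQuadratic r * θ ^ 2 / 2)) * (1 - Complex.I * (saddleCubic r * θ ^ 3 : ℝ))

/-- Write `exp g = e^{-S/2} e^w` with `w = -ib + R`. Since the approximation is `e^{-S/2} (1 - ib)`,
the difference is `e^{-S/2} (e^w - 1 - w) + e^{-S/2} R`: a square of the cubic size, plus the
quartic remainder. -/
theorem norm_cexp_saddleExponent_sub_saddleApprox_le {r θ : ℝ} (hr : 1 ≤ r) (h : r * |θ| ≤ 1) :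
    ‖Complex.exp (saddleExponent r θ) - saddleApprox r θ‖ ≤ Real.exp (-r) *
      ((256 * (saddleQuadratic r * θ ^ 2) ^ 3 + 15 * (saddleQuadratic r * θ ^ 2) ^ 2) *
        Real.exp (-(saddleQuadratic r * θ ^ 2 / 25))) := by
  have hre := saddleExponent_re_le_of_abs_le hr h
  have hX := sq_mul_exp_mul_sq_le_saddleQuadratic_mul_sq hr θ
  have hB := saddleCubic_mul_le hr θ
  have hB0 := saddleCubic_nonneg hr
  have hR := norm_saddleExponent_sub_taylor_le hr θ
  set S := saddleQuadratic r * θ ^ 2 with hS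
  set b := saddleCubic r * θ ^ 3 with hb
  set g := saddleExponent r θ with hg
  set x := r * |θ| with hx
  have hx0 : 0 ≤ x := by positivity
  have hS0 : 0 ≤ S := le_trans (by positivity) hX
  set w : ℂ := g + (S / 2 : ℝ) with hw
  set R : ℂ := w + Complex.I * b with hRdef
  have hE : Real.exp (-r) * Real.exp r = 1 := by rw [← Real.exp_add]; simp
  have e4 : Real.exp r * x ^ 4 ≤ Real.exp (-r) * S ^ 2 := by
    calc Real.exp r * x ^ 4 = Real.exp (-r) * Real.exp r * (Real.exp r * x ^ 4) := by
          rw [hE, one_mul]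
      _ = Real.exp (-r) * (Real.exp r * x ^ 2) ^ 2 := by ring
      _ ≤ _ := by gcongr
  -- `16 = 1 + 15`: the cubic term plus the quartic remainder, with `x⁴ ≤ x³`.
  have hwn : ‖w‖ ≤ 16 * (Real.exp r * x ^ 3) := by
    have h1 : ‖Complex.I * (b : ℂ)‖ ≤ Real.exp r * x ^ 3 := by
      rw [norm_mul, Complex.norm_I, one_mul, Complex.norm_real, Real.norm_eq_abs, hb, abs_mul,
        abs_of_nonneg hB0, abs_pow]
      exact hB
    have h2 : x ^ 4 ≤ x ^ 3 := pow_le_pow_of_le_one hx0 h (by norm_num)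
    have h3 := mul_le_mul_of_nonneg_left h2 (Real.exp_pos r).le
    have h4 : ‖w‖ ≤ ‖R‖ + ‖Complex.I * (b : ℂ)‖ := by
      rw [show w = R - Complex.I * b by rw [hRdef]; ring]
      exact norm_sub_le _ _
    linarith
  have hw2 : ‖w‖ ^ 2 ≤ Real.exp (-r) * (256 * S ^ 3) := by
    calc ‖w‖ ^ 2 ≤ (16 * (Real.exp r * x ^ 3)) ^ 2 := by gcongr
      _ = 256 * ((Real.exp (-r) * Real.exp r) * (Real.exp r * x ^ 3) ^ 2) := by rw [hE]; ring
      _ = Real.exp (-r) * (256 * (Real.exp r * x ^ 2) ^ 3) := by ring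
      _ ≤ _ := by gcongr
  -- As `Re w = Re g + S/2`, the product is the maximum of `e^{-S/2}` and `e^{Re g}`, both at most
  -- `e^{-S/25}`.
  have hmax : Real.exp (-(S / 2)) * max 1 (Real.exp w.re) ≤ Real.exp (-(S / 25)) := by
    rw [mul_max_of_nonneg _ _ (Real.exp_pos _).le, mul_one, ← Real.exp_add]
    refine max_le (Real.exp_le_exp.2 (by linarith)) (Real.exp_le_exp.2 ?_)
    rw [hw, Complex.add_re, Complex.ofReal_re]
    linarith
  have hsplit : Complex.exp g - saddleApprox r θ =
      Real.exp (-(S / 2)) * (Complex.exp w - 1 - w) + Real.exp (-(S / 2)) * R := by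
    have : Complex.exp g = Real.exp (-(S / 2)) * Complex.exp w := by
      rw [Complex.ofReal_exp, ← Complex.exp_add, hw]
      congr 1
      push_cast
      ring
    rw [this, saddleApprox, ← hS, ← hb, hRdef]
    ring
  rw [hsplit]
  have hn : ∀ z : ℂ, ‖(Real.exp (-(S / 2)) : ℂ) * z‖ = Real.exp (-(S / 2)) * ‖z‖ := fun z => by
    rw [norm_mul, Complex.norm_real, Real.norm_of_nonneg (Real.exp_pos _).le]
  refine (norm_add_le _ _).trans ?_
  rw [hn, hn]
  have t1 : Real.exp (-(S / 2)) * ‖Complex.exp w - 1 - w‖ ≤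
      Real.exp (-r) * (256 * S ^ 3) * Real.exp (-(S / 25)) := by
    calc _ ≤ Real.exp (-(S / 2)) * (‖w‖ ^ 2 * max 1 (Real.exp w.re)) := by
          gcongr
          exact norm_cexp_sub_one_sub_id_le_sq_mul_max w
      _ = ‖w‖ ^ 2 * (Real.exp (-(S / 2)) * max 1 (Real.exp w.re)) := by ring
      _ ≤ _ := by gcongr
  have t2 : Real.exp (-(S / 2)) * ‖R‖ ≤ Real.exp (-(S / 25)) * (15 * (Real.exp (-r) * S ^ 2)) := by
    have : ‖R‖ ≤ 15 * (Real.exp (-r) * S ^ 2) := hR.trans (by gcongr)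
    gcongr
    linarith
  linarith

theorem exp_le_saddleQuadratic_mul_sq {r θ : ℝ} (hr : 1 ≤ r) (h : 1 ≤ r * |θ|) :
    Real.exp r ≤ saddleQuadratic r * θ ^ 2 :=
  (le_mul_of_one_le_right (Real.exp_pos r).le (one_le_pow₀ h)).trans
    (sq_mul_exp_mul_sq_le_saddleQuadratic_mul_sq hr θ)

theorem norm_saddleApprox_le {r θ : ℝ} (hr : 1 ≤ r) (h : 1 ≤ r * |θ|) :
    ‖saddleApprox r θ‖ ≤ Real.exp (-r) *
      ((saddleQuadratic r * θ ^ 2 + (saddleQuadratic r * θ ^ 2) ^ 3) *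
        Real.exp (-(saddleQuadratic r * θ ^ 2 / 25))) := by
  have hX := sq_mul_exp_mul_sq_le_saddleQuadratic_mul_sq hr θ
  have hS1 := exp_le_saddleQuadratic_mul_sq hr h
  have hB := saddleCubic_mul_le hr θ
  have hB0 := saddleCubic_nonneg hr
  rw [saddleApprox, norm_mul, Complex.norm_real, Real.norm_of_nonneg (Real.exp_pos _).le]
  set S := saddleQuadratic r * θ ^ 2 with hS
  set x := r * |θ| with hx
  have hS0 : 0 ≤ S := (Real.exp_pos r).le.trans hS1
  have hE : Real.exp (-r) * Real.exp r = 1 := by rw [← Real.exp_add]; simp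
  have h1 : ‖1 - Complex.I * ((saddleCubic r * θ ^ 3 : ℝ) : ℂ)‖ ≤ 1 + S ^ 2 := by
    refine (norm_sub_le _ _).trans ?_
    rw [norm_one, norm_mul, Complex.norm_I, one_mul, Complex.norm_real, Real.norm_eq_abs, abs_mul,
        abs_of_nonneg hB0, abs_pow]
    gcongr
    calc _ ≤ Real.exp r * x ^ 3 := hB
      _ ≤ Real.exp r * x ^ 4 := by
        gcongr ?_ * ?_
        exact pow_le_pow_right₀ h (by norm_num)
      _ = 1 * Real.exp r * x ^ 4 := by rw [one_mul]
      _ ≤ Real.exp r * Real.exp r * x ^ 4 := by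
        gcongr
        exact Real.one_le_exp (by linarith)
      _ = (Real.exp r * x ^ 2) ^ 2 := by ring
      _ ≤ S ^ 2 := by gcongr
  -- Outside the central arc `S ≥ e^r`, so the factor `e^{-r}` is bought with one more power of `S`.
  have h2 : 1 ≤ Real.exp (-r) * S := by
    rw [← hE]
    gcongr
  calc _ ≤ Real.exp (-(S / 25)) * (1 + S ^ 2) := by
        gcongr
        linarith
    _ ≤ (Real.exp (-(S / 25)) * (1 + S ^ 2)) * (Real.exp (-r) * S) :=
        le_mul_of_one_le_right (by positivity) h2
    _ = _ := by ring

/-- `S³ e^{-S/(30r²)} ≤ 3! (30r²)³ = 162000 r⁶`, and `r⁶ ≤ 6! e^r`. Since `1 + S ≤ 2S`, dividing by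
`S² ≥ e^{2r}` leaves `233280000 e^{-r}`. -/
theorem norm_cexp_saddleExponent_le {r θ : ℝ} (hr : 1 ≤ r) (h : 1 ≤ r * |θ|)
    (hθ : |θ| ≤ Real.pi) : ‖Complex.exp (saddleExponent r θ)‖ * (1 + saddleQuadratic r * θ ^ 2) ≤
      300000000 * Real.exp (-r) := by
  have hS1 := exp_le_saddleQuadratic_mul_sq hr h
  have hre := saddleExponent_re_le hr hθ
  rw [Complex.norm_exp]
  set S := saddleQuadratic r * θ ^ 2 with hS
  have hE : Real.exp (-r) * Real.exp r = 1 := by rw [← Real.exp_add]; simp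
  have hS0 : 1 ≤ S := (Real.one_le_exp (by linarith)).trans hS1
  have h1 := pow_mul_exp_neg_div_le (c := 30 * r ^ 2) (S := S) (by positivity) (by linarith) 3
  have h2 := Real.pow_div_factorial_le_exp r (by linarith) 6
  norm_num [Nat.factorial] at h1 h2
  have h3 : S ^ 3 * Real.exp (saddleExponent r θ).re ≤ 162000 * r ^ 6 := by
    calc _ ≤ S ^ 3 * Real.exp (-(S / (30 * r ^ 2))) := by gcongr
      _ ≤ _ := h1
      _ = _ := by ring
  have h4 : r ^ 6 ≤ 720 * Real.exp r := by linarith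
  have h5 : S ^ 2 * (Real.exp (saddleExponent r θ).re * (1 + S)) ≤ 233280000 * Real.exp r := by
    calc _ ≤ S ^ 2 * (Real.exp (saddleExponent r θ).re * (S + S)) := by gcongr
      _ = 2 * (S ^ 3 * Real.exp (saddleExponent r θ).re) := by ring
      _ ≤ _ := by linarith
  have h6 : Real.exp r ^ 2 * (Real.exp (saddleExponent r θ).re * (1 + S)) ≤
      233280000 * Real.exp r := le_trans (by gcongr) h5
  calc _ = (Real.exp (-r) * Real.exp r) ^ 2 * (Real.exp (saddleExponent r θ).re * (1 + S)) := by
        rw [hE]; ring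
    _ = Real.exp (-r) ^ 2 * (Real.exp r ^ 2 * (Real.exp (saddleExponent r θ).re * (1 + S))) := by
        ring
    _ ≤ Real.exp (-r) ^ 2 * (233280000 * Real.exp r) := by gcongr
    _ = 233280000 * Real.exp (-r) * (Real.exp (-r) * Real.exp r) := by ring
    _ ≤ _ := by rw [hE]; linarith [Real.exp_pos (-r)]

/-- The kernel `(1 + A θ²)⁻¹` is chosen for its exact integral `π / √A`, the same scale as the
Gaussian integral `√(2π / A)`. -/
theorem exists_norm_indicator_sub_saddleApprox_le : ∃ C : ℝ, 0 < C ∧ ∀ r θ : ℝ, 1 ≤ r →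
    ‖(Set.Ioc (-Real.pi) Real.pi).indicator (fun θ => Complex.exp (saddleExponent r θ)) θ -
      saddleApprox r θ‖ ≤ C * Real.exp (-r) * (1 + saddleQuadratic r * θ ^ 2)⁻¹ := by
  refine ⟨10 ^ 10, by norm_num, fun r θ hr => ?_⟩
  have hX := sq_mul_exp_mul_sq_le_saddleQuadratic_mul_sq hr θ
  have hS0 : 0 ≤ saddleQuadratic r * θ ^ 2 := le_trans (by positivity) hX
  rw [← div_eq_mul_inv, le_div_iff₀ (by linarith)]
  have hm := fun m => pow_mul_exp_neg_div_le (c := 25) (by norm_num) hS0 m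
  have h1 := hm 1
  have h2 := hm 2
  have h3 := hm 3
  have h4 := hm 4
  norm_num [Nat.factorial] at h1 h2 h3 h4
  rcases le_total (r * |θ|) 1 with h | h
  · have hmem : θ ∈ Set.Ioc (-Real.pi) Real.pi := by
      have : |θ| ≤ 1 := by nlinarith [abs_nonneg θ]
      constructor <;> linarith [Real.pi_gt_three, (abs_le.1 this).1, (abs_le.1 this).2]
    rw [Set.indicator_of_mem hmem]
    have := norm_cexp_saddleExponent_sub_saddleApprox_le hr h
    set S := saddleQuadratic r * θ ^ 2 with hS
    calc _ ≤ Real.exp (-r) * ((256 * S ^ 3 + 15 * S ^ 2) * Real.exp (-(S / 25))) * (1 + S) := by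
          gcongr
      _ = Real.exp (-r) * (256 * (S ^ 4 * Real.exp (-(S / 25))) +
          271 * (S ^ 3 * Real.exp (-(S / 25))) + 15 * (S ^ 2 * Real.exp (-(S / 25)))) := by ring
      _ ≤ Real.exp (-r) * 10 ^ 10 := by gcongr; linarith
      _ = _ := by ring
  · have ha := norm_saddleApprox_le hr h
    have hb : ‖(Set.Ioc (-Real.pi) Real.pi).indicator
        (fun θ => Complex.exp (saddleExponent r θ)) θ‖ * (1 + saddleQuadratic r * θ ^ 2) ≤
        300000000 * Real.exp (-r) := by
      by_cases hmem : θ ∈ Set.Ioc (-Real.pi) Real.pi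
      · rw [Set.indicator_of_mem hmem]
        exact norm_cexp_saddleExponent_le hr h (abs_le.2 ⟨hmem.1.le, hmem.2⟩)
      · rw [Set.indicator_of_notMem hmem, norm_zero, zero_mul]
        positivity
    set S := saddleQuadratic r * θ ^ 2 with hS
    have hc : ‖saddleApprox r θ‖ * (1 + S) ≤ 10 ^ 9 * Real.exp (-r) := by
      calc _ ≤ Real.exp (-r) * ((S + S ^ 3) * Real.exp (-(S / 25))) * (1 + S) := by gcongr
        _ = Real.exp (-r) * (S ^ 4 * Real.exp (-(S / 25)) + S ^ 3 * Real.exp (-(S / 25)) +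
          S ^ 2 * Real.exp (-(S / 25)) + S * Real.exp (-(S / 25))) := by ring
        _ ≤ Real.exp (-r) * 10 ^ 9 := by gcongr; linarith
        _ = _ := by ring
    have := mul_le_mul_of_nonneg_right (norm_sub_le ((Set.Ioc (-Real.pi) Real.pi).indicator
        (fun θ => Complex.exp (saddleExponent r θ)) θ) (saddleApprox r θ))
        (by linarith : 0 ≤ 1 + S)
    linarith [Real.exp_pos (-r)]

/-! ### Integration over the line -/

theorem saddleQuadratic_pos {r : ℝ} (hr : 0 < r) : 0 < saddleQuadratic r := by
  unfold saddleQuadratic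
  positivity

theorem continuous_saddleExponent (r : ℝ) : Continuous (saddleExponent r) := by
  unfold saddleExponent
  fun_prop

theorem continuous_saddleApprox (r : ℝ) : Continuous (saddleApprox r) := by
  unfold saddleApprox
  fun_prop

theorem integrable_inv_one_add_mul_sq {a : ℝ} (ha : 0 < a) :
    Integrable fun x : ℝ => (1 + a * x ^ 2)⁻¹ := by
  have h := integrable_inv_one_add_sq.comp_mul_left' (Real.sqrt_pos.2 ha).ne'
  simpa only [mul_pow, Real.sq_sqrt ha.le] using h

theorem integral_inv_one_add_mul_sq {a : ℝ} (ha : 0 < a) :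
    ∫ x : ℝ, (1 + a * x ^ 2)⁻¹ = Real.pi / Real.sqrt a := by
  have h := Measure.integral_comp_mul_left (fun x : ℝ => (1 + x ^ 2)⁻¹) (Real.sqrt a)
  simp only [mul_pow, Real.sq_sqrt ha.le] at h
  rw [h, integral_univ_inv_one_add_sq, abs_of_pos (inv_pos.2 (Real.sqrt_pos.2 ha)), smul_eq_mul]
  ring

/-- Averaging over `θ ↦ -θ` removes the odd cubic correction and leaves the pure Gaussian. -/
theorem integral_saddleApprox {r : ℝ} (hi : Integrable (saddleApprox r)) :
    ∫ θ, saddleApprox r θ = Real.sqrt (2 * Real.pi / saddleQuadratic r) := by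
  have h1 : ∫ θ, saddleApprox r (-θ) = ∫ θ, saddleApprox r θ :=
    integral_neg_eq_self (saddleApprox r) volume
  have h2 := integral_add hi hi.comp_neg
  rw [h1] at h2
  have h3 : ∀ θ, saddleApprox r θ + saddleApprox r (-θ) =
      2 * ((Real.exp (-(saddleQuadratic r / 2) * θ ^ 2) : ℝ) : ℂ) := fun θ => by
    rw [saddleApprox, saddleApprox, neg_sq,
      show -(saddleQuadratic r / 2) * θ ^ 2 = -(saddleQuadratic r * θ ^ 2 / 2) by ring]
    push_cast
    ring
  simp only [h3] at h2
  rw [integral_const_mul, integral_complex_ofReal, integral_gaussian] at h2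
  rw [show 2 * Real.pi / saddleQuadratic r = Real.pi / (saddleQuadratic r / 2) by
    rw [div_div_eq_mul_div, mul_comm]]
  linear_combination -h2 / 2

/-- The saddle point estimate of the Cauchy integral. -/
theorem exists_norm_integral_cexp_saddleExponent_sub_le : ∃ C : ℝ, 0 < C ∧ ∀ r : ℝ, 1 ≤ r →
    ‖(∫ θ in (-Real.pi)..Real.pi, Complex.exp (saddleExponent r θ)) -
      (Real.sqrt (2 * Real.pi / saddleQuadratic r) : ℝ)‖ ≤
      C * Real.exp (-r) * (Real.pi / Real.sqrt (saddleQuadratic r)) := by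
  obtain ⟨C, hC, h⟩ := exists_norm_indicator_sub_saddleApprox_le
  refine ⟨C, hC, fun r hr => ?_⟩
  have hA := saddleQuadratic_pos (by linarith : 0 < r)
  set Φ := (Set.Ioc (-Real.pi) Real.pi).indicator fun θ => Complex.exp (saddleExponent r θ) with hΦ
  have hΦi : Integrable Φ := by
    refine (integrable_indicator_iff measurableSet_Ioc).2 ?_
    exact (Complex.continuous_exp.comp (continuous_saddleExponent r)).integrableOn_Ioc
  have hK : Integrable fun θ : ℝ => C * Real.exp (-r) * (1 + saddleQuadratic r * θ ^ 2)⁻¹ :=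
    (integrable_inv_one_add_mul_sq hA).const_mul _
  have hd : Integrable fun θ => Φ θ - saddleApprox r θ :=
    hK.mono' (hΦi.aestronglyMeasurable.sub (continuous_saddleApprox r).aestronglyMeasurable)
      (Filter.Eventually.of_forall fun θ => h r θ hr)
  -- Integrability follows from that of the cut-off integrand and of the dominated difference.
  have ha : Integrable (saddleApprox r) := by
    convert hΦi.sub hd using 1
    ext θ
    simp
  rw [intervalIntegral.integral_of_le (by linarith [Real.pi_pos]),
    ← integral_indicator measurableSet_Ioc, ← integral_saddleApprox ha, ← integral_sub hΦi ha,
    ← integral_inv_one_add_mul_sq hA, ← integral_const_mul]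
  exact norm_integral_le_of_norm_le hK (Filter.Eventually.of_forall fun θ => h r θ hr)

/-! ### Return to Bell numbers -/

/-- The saddle condition turns the Cauchy factor `e^{-inθ}` into `e^{-i r e^r θ}`, exactly the
linear term subtracted in `saddleExponent`. -/
theorem intervalIntegral_cexp_saddleExponent {n : ℕ} {r : ℝ} (hr : 0 < r)
    (hn : r * Real.exp r = n) :
    ∫ θ in (-Real.pi)..Real.pi, Complex.exp (saddleExponent r θ) =
      ((2 * Real.pi * r ^ n / n.factorial * bellNumber n / Real.exp (Real.exp r - 1) : ℝ) : ℂ) := by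
  have h := intervalIntegral_cexp_cexp_circle n hr
  have e : ∀ θ : ℝ, Complex.exp (saddleExponent r θ) = Complex.exp (-Real.exp r) *
      (Complex.exp (Complex.exp (r * Complex.exp (θ * Complex.I))) *
        Complex.exp (-(n * θ * Complex.I))) := fun θ => by
    have hn' : (r : ℂ) * Complex.exp r = n := by exact_mod_cast congrArg Complex.ofReal hn
    rw [← Complex.exp_add, ← Complex.exp_add, saddleExponent,
      show (r : ℂ) * (Complex.exp (θ * Complex.I) - 1) = r * Complex.exp (θ * Complex.I) - r by ring,
      Complex.exp_sub, Complex.ofReal_exp, ← hn']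
    congr 1
    have := Complex.exp_ne_zero r
    field_simp
    ring
  simp only [e]
  rw [intervalIntegral.integral_const_mul, h, Real.exp_sub]
  have h1 : (Real.exp (Real.exp r) : ℂ) ≠ 0 := by exact_mod_cast (Real.exp_pos _).ne'
  have h2 : Complex.exp (-Real.exp r) = (Real.exp (Real.exp r) : ℂ)⁻¹ := by
    rw [Complex.exp_neg, Complex.ofReal_exp (Real.exp r)]
  rw [h2]
  push_cast
  field_simp

theorem lambertR_pos {n : ℕ} (hn : 1 ≤ n) : 0 < lambertR n := by
  have h := lambertR_mul_exp n
  have : (0 : ℝ) < n := by exact_mod_cast hn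
  exact pos_of_mul_pos_left (h ▸ this) (Real.exp_pos _).le

theorem one_le_lambertR {n : ℕ} (hn : 3 ≤ n) : 1 ≤ lambertR n := by
  by_contra! hlt
  have h := lambertR_mul_exp n
  have h1 : Real.exp (lambertR n) < Real.exp 1 := Real.exp_lt_exp.2 hlt
  have h2 : (3 : ℝ) ≤ n := by exact_mod_cast hn
  have h3 := lambertR_pos (by omega : 1 ≤ n)
  nlinarith [Real.exp_one_lt_d9, Real.exp_pos (lambertR n)]

theorem bellMainTerm_pos {n : ℕ} (hn : 1 ≤ n) : 0 < bellMainTerm n := by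
  have := lambertR_pos hn
  unfold bellMainTerm
  positivity

theorem exists_bellNumber_eq_of_three_le : ∃ C : ℝ, 0 < C ∧ ∀ n : ℕ, 3 ≤ n →
    ∃ ε : ℝ, |ε| ≤ C * Real.exp (-lambertR n) ∧
      (bellNumber n : ℝ) = bellMainTerm n * (1 + ε) := by
  obtain ⟨C, hC, h⟩ := exists_norm_integral_cexp_saddleExponent_sub_le
  have hpi := Real.pi_pos
  refine ⟨C * Real.sqrt (2 * Real.pi), by positivity, fun n hn => ?_⟩
  have hr1 := one_le_lambertR hn
  have hrn := lambertR_mul_exp n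
  rw [bellMainTerm]
  set r := lambertR n with hr
  have hr0 : 0 < r := by linarith
  have hb := h r hr1
  have hA := saddleQuadratic_pos hr0
  rw [intervalIntegral_cexp_saddleExponent hr0 hrn, ← Complex.ofReal_sub, Complex.norm_real,
    Real.norm_eq_abs] at hb
  rw [show 2 * Real.pi * r * (r + 1) * Real.exp r = 2 * Real.pi * saddleQuadratic r by
    rw [saddleQuadratic]; ring]
  set A := saddleQuadratic r with hAdef
  set j := 2 * Real.pi * r ^ n / n.factorial * bellNumber n / Real.exp (Real.exp r - 1) with hj
  rw [Real.sqrt_div (by positivity)] at hb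
  rw [Real.sqrt_mul (by positivity : 0 ≤ 2 * Real.pi) A]
  set p := Real.sqrt (2 * Real.pi) with hp
  set s := Real.sqrt A with hs
  have hp2 : p * p = 2 * Real.pi := Real.mul_self_sqrt (by positivity)
  have hp0 : 0 < p := Real.sqrt_pos.2 (by positivity)
  have hs0 : 0 < s := Real.sqrt_pos.2 hA
  have hf : (0 : ℝ) < n.factorial := by positivity
  -- `j` is the Cauchy integral and `p / s` its Gaussian value, so `ε` is the relative error; `π =
  -- p² / 2` bounds it by `C e^{-r} p / 2`.
  refine ⟨j * s / p - 1, ?_, ?_⟩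
  · have e1 : j * s / p - 1 = (j - p / s) * (s / p) := by field_simp
    rw [e1, abs_mul, abs_of_pos (by positivity : 0 < s / p)]
    refine (mul_le_mul_of_nonneg_right hb (by positivity)).trans ?_
    have e2 : C * Real.exp (-r) * (Real.pi / s) * (s / p) = C * Real.exp (-r) * (p / 2) := by
      field_simp
      linarith
    rw [e2]
    nlinarith [mul_pos (mul_pos hC (Real.exp_pos (-r))) hp0]
  · rw [hj, add_sub_cancel]
    have := Real.exp_pos (Real.exp r - 1)
    field_simp
    linear_combination (bellNumber n : ℝ) * hp2

theorem corollary3 :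
    ∃ C : ℝ, 0 < C ∧ ∀ n : ℕ, 1 ≤ n →
      ∃ ε : ℝ, |ε| ≤ C * Real.exp (-lambertR n) ∧
        (bellNumber n : ℝ) = bellMainTerm n * (1 + ε) := by
  obtain ⟨C, hC, h⟩ := exists_bellNumber_eq_of_three_le
  set d : ℕ → ℝ := fun n => |bellNumber n / bellMainTerm n - 1| * Real.exp (lambertR n) with hd
  have hd0 : ∀ n, 0 ≤ d n := fun n => by positivity
  -- The cases `n = 1, 2` are absorbed by adding their own errors to the constant; the term `n = 0`
  -- is only an extra nonnegative summand.
  refine ⟨C + ∑ n ∈ Finset.range 3, d n,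
    add_pos_of_pos_of_nonneg hC (Finset.sum_nonneg fun n _ => hd0 n), fun n hn => ?_⟩
  rcases le_or_gt 3 n with h3 | h3
  · obtain ⟨ε, hε, he⟩ := h n h3
    refine ⟨ε, hε.trans ?_, he⟩
    gcongr
    exact le_add_of_nonneg_right (Finset.sum_nonneg fun n _ => hd0 n)
  · have hM := (bellMainTerm_pos hn).ne'
    refine ⟨bellNumber n / bellMainTerm n - 1, ?_, by field_simp; ring⟩
    have h1 := Finset.single_le_sum (fun m _ => hd0 m) (Finset.mem_range.2 h3)
    calc |bellNumber n / bellMainTerm n - 1| = d n * Real.exp (-lambertR n) := by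
          rw [hd, mul_assoc, ← Real.exp_add, add_neg_cancel, Real.exp_zero, mul_one]
      _ ≤ _ := by
        gcongr
        linarith
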